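/- Let $G$ be an $n$-player normal-form game with finite action sets $\mathcal A_i$ and utilities $u_i:\prod_j\mathcal A_j\to\mathbb R$; for independent mixed strategies $s_j\in\Delta(\mathcal A_j)$ write $u_i(s_1,\dots,s_n)$ for the expected utility. In the uncorrelated program game of $G$, each player $i$ submits a deterministic program $p_i$, which receives the source codes of all submitted programs (its opponents' $p_{-i}$ and its own) and a sequence $(r^i_m)_{m\ge 0}\in[0,1]^{\mathbb N}$, and outputs an action in $\mathcal A_i$. The sequences are independent over $i$ and each is i.i.d. $U[0,1]$. Programs are codes for partial recursive functions that may in addition test instantaneously whether $r_m<c$, for rational constants $c$ and for the real constants $c$ of an arbitrary fixed sequence. Write $\mathrm{apply}(p_j,(p_{-j},r))$ for the result of running $p_j$ against $p_{-j}$ on the sequence $r$ (undefined if no action is output). A profile $(p_1,\dots,p_n)$ is a program equilibrium if its programs almost surely halt against each other and, for each $i$, no program $p_i'$ such that $p_i',p_{-i}$ almost surely halt against each other gives player $i$ a higher expected utility against $p_{-i}$. The payoffs of the equilibrium are the expected utilities. For $\epsilon>0$ and a policy $\pi$, which maps an action history $\boldsymbol a^{1:T}\in(\prod_j\mathcal A_j)^T$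 and $r_0,\dots,r_T\in[0,1]$ (for any $T\ge 0$) to an action of player $i$, a program $p_i$ is an uncorrelated $\epsilon$Grounded$\pi$Bot for player $i$ if, against any opponents $p_{-i}$ and for almost every input sequence $(r_m)$, its result is that of the following algorithm: let $T=\min\{t: r_t<\epsilon\}$; for $t=1,\dots,T$ and all $j=1,\dots,n$ let $a^t_j=\mathrm{apply}(p_j,(p_{-j},(r_m)_{m\ge T+1-t}))$; return $\pi(\boldsymbol a^{1:T};r_{0:T})$. Suppose that $(p_1,\dots,p_n)$ is a program equilibrium with payoffs $v_1,\dots,v_n$, in which each $p_i$ is an uncorrelated $\epsilon_i$Grounded$\pi_i$Bot for player $i$, for some $\epsilon_i>0$ and some policy $\pi_i$. Let $s_i\in\Delta(\mathcal A_i)$ be the distribution of the action output by $p_i$ in this equilibrium. Then $v_{1:n}$ is feasible without correlation, namely $v_i=u_i(s_1,\dots,s_n)$ for all $i$, and for each $i$ $$v_i\ \ge\ \min_{(S_j':\mathcal A_i\to\Delta(\mathcal A_j))_{j\ne i}}\ \max_{q\in[0,1],\ s_i'\in\Delta(\mathcal A_i)} u_i\Bigl((1-q)s_i+q s_i',\ \bigl((1-q)s_j+q\,S_j'\bullet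 s_i'\bigr)_{j\ne i}\Bigr),$$ where $S_j'\bullet s_i'=\sum_{a\in\mathcal A_i}s_i'(a)\,S_j'(a)$ (and the minimum and the maximum are attained). -/

import Mathlib

namespace ProgramGames

open MeasureTheory

/-! ### Normal-form games -/

/-- An `n`-player normal-form game. The finite action set of player `i` is numbered,
`{0, …, numActions i - 1}`, since programs output numbers. -/
structure Game (n : ℕ) where
  numActions : Fin n → ℕ
  utility : Fin n → (∀ i, Fin (numActions i)) → ℝ

namespace Game

variable {n : ℕ} (G : Game n)

/-- The action set of player `i`. -/
abbrev Action (i : Fin n) : Type := Fin (G.numActions i)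

/-- Action profiles. -/
abbrev Profile : Type := ∀ i, G.Action i

/-- The set of strategies `Δ(A i)`: probability distributions on the actions of player `i`. -/
abbrev strategies (i : Fin n) : Set (G.Action i → ℝ) := stdSimplex ℝ (G.Action i)

/-- `u_i(s_1, …, s_n)`: expected utility of player `i` when the players act independently,
player `j` with distribution `s j`. -/
noncomputable def mixedUtility (i : Fin n) (s : ∀ j, G.Action j → ℝ) : ℝ :=
  ∑ a : G.Profile, G.utility i a * ∏ j, s j (a j)

/-- Payoffs `v` are feasible without correlation. -/
def Feasible (v : Fin n → ℝ) : Prop :=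
  ∃ s : ∀ j, G.Action j → ℝ, (∀ j, s j ∈ G.strategies j) ∧ ∀ i, v i = G.mixedUtility i s

/-- The profile in which player `i` plays `(1 - q) s_i + q s'` and every other player `j` plays
`(1 - q) s_j + q (S'_j • s')`, where `S'_j • s' = ∑ a, s' a • S'_j a`
(the component of `S'` at `j = i` is never used). -/
def deviationProfile (s : ∀ j, G.Action j → ℝ) (i : Fin n)
    (S' : ∀ j, G.Action i → G.Action j → ℝ) (q : ℝ) (s' : G.Action i → ℝ) :
    ∀ j, G.Action j → ℝ :=
  Function.update (fun j b => (1 - q) * s j b + q * ∑ a, s' a * S' j a b)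
    i (fun b => (1 - q) * s i b + q * s' b)

/-- `x` is the maximum, over `q ∈ [0,1]` and `s' ∈ Δ(A i)`, of player `i`'s utility in the
deviation profile with punishments `S'`. -/
def IsMaxDeviationUtility (s : ∀ j, G.Action j → ℝ) (i : Fin n)
    (S' : ∀ j, G.Action i → G.Action j → ℝ) (x : ℝ) : Prop :=
  IsGreatest {y : ℝ | ∃ q ∈ Set.Icc (0 : ℝ) 1, ∃ s' ∈ G.strategies i,
    y = G.mixedUtility i (G.deviationProfile s i S' q s')} x

/-- `x` is the minimum, over the punishments `S'_j : A i → Δ(A j)`, of the maximum over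
`q ∈ [0,1]` and `s' ∈ Δ(A i)` of player `i`'s utility in the deviation profile. -/
def IsMinMaxDeviationUtility (s : ∀ j, G.Action j → ℝ) (i : Fin n) (x : ℝ) : Prop :=
  IsLeast {y : ℝ | ∃ S' : ∀ j, G.Action i → G.Action j → ℝ,
    (∀ j a, S' j a ∈ G.strategies j) ∧ G.IsMaxDeviationUtility s i S' y} x

end Game

/-! ### Programs -/

/-- Random input sequences `(r_m)` with `r_m ∈ [0,1]`. -/
abbrev RandSeq : Type := ℕ → unitInterval

/-- The law of an i.i.d. `U[0,1]` sequence. -/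
noncomputable def seqLaw : Measure RandSeq :=
  Measure.infinitePi fun _ : ℕ => (volume : Measure unitInterval)

/-- The tail `(r_m)_{m ≥ k}`. -/
def RandSeq.drop (k : ℕ) (r : RandSeq) : RandSeq := fun m => r (k + m)

/-- Source code of programs: codes for partial recursive functions, together with
instantaneous comparisons of entries of the random input sequence with rational constants
and with the entries of a fixed table of real constants. -/
inductive Code : Type
  | zero : Code
  | succ : Code
  | left : Code
  | right : Code
  | pair : Code → Code → Code
  | comp : Code → Code → Code
  | prec : Code → Code → Code
  | rfind' : Code → Code
  | ltRat : Code
  | ltConst : Code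

namespace Code

/-- Effective numbering of source codes, by which programs are given to programs as input. -/
def toNat : Code → ℕ
  | zero => Nat.pair 0 0
  | succ => Nat.pair 1 0
  | left => Nat.pair 2 0
  | right => Nat.pair 3 0
  | ltRat => Nat.pair 4 0
  | ltConst => Nat.pair 5 0
  | pair f g => Nat.pair 6 (Nat.pair f.toNat g.toNat)
  | comp f g => Nat.pair 7 (Nat.pair f.toNat g.toNat)
  | prec f g => Nat.pair 8 (Nat.pair f.toNat g.toNat)
  | rfind' f => Nat.pair 9 f.toNat

theorem toNat_injective : Function.Injective toNat := by
  intro c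
  induction c with
  | zero | succ | left | right | ltRat | ltConst =>
    intro d h
    cases d <;> simp [toNat, Nat.pair_eq_pair] at h ⊢
  | pair f g hf hg | comp f g hf hg | prec f g hf hg =>
    intro d h
    cases d <;> simp [toNat, Nat.pair_eq_pair] at h ⊢
    exact ⟨hf h.1, hg h.2⟩
  | rfind' f hf =>
    intro d h
    cases d <;> simp [toNat, Nat.pair_eq_pair] at h ⊢
    exact hf h

open Classical in
/-- The partial function computed by a code with random input sequence `r`, where `θ` is the
table of real constants. On input `⟨m, ⟨a, b⟩⟩`, `ltRat` returns the truth value of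
`r_m < a / (b + 1)`; on input `⟨m, k⟩`, `ltConst` returns the truth value of `r_m < θ k`. -/
noncomputable def eval (θ : ℕ → ℝ) (r : RandSeq) : Code → ℕ →. ℕ
  | zero => fun _ => Part.some 0
  | succ => fun x => Part.some (x + 1)
  | left => fun x => Part.some x.unpair.1
  | right => fun x => Part.some x.unpair.2
  | pair f g => fun x => Nat.pair <$> eval θ r f x <*> eval θ r g x
  | comp f g => fun x => eval θ r g x >>= eval θ r f
  | prec f g =>
    Nat.unpaired fun a k =>
      k.rec (eval θ r f a) fun y IH => do
        let i ← IH
        eval θ r g (Nat.pair a (Nat.pair y i))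
  | rfind' f =>
    Nat.unpaired fun a m =>
      (Nat.rfind fun k => (fun y => y = 0) <$> eval θ r f (Nat.pair a (k + m))).map (· + m)
  | ltRat => fun x => Part.some <|
      if (r x.unpair.1 : ℝ) < (x.unpair.2.unpair.1 : ℝ) / ((x.unpair.2.unpair.2 : ℝ) + 1)
      then 1 else 0
  | ltConst => fun x => Part.some <|
      if (r x.unpair.1 : ℝ) < θ x.unpair.2 then 1 else 0

end Code

/-! ### Uncorrelated program games -/

section ProgramGame

variable {n : ℕ} (G : Game n) (θ : ℕ → ℝ)

/-- The input number that encodes the source codes of a program profile. -/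
def encodeProfile (p : Fin n → Code) : ℕ :=
  Encodable.encode (List.ofFn fun j => (p j).toNat)

/-- `apply(p_i, (p_{-i}, r))`: run program `i` on the source codes of the profile (the opponents'
and its own) and on the random sequence `r`. It is undefined if the program does not halt, or
does not output an action of player `i`. -/
noncomputable def apply (p : Fin n → Code) (i : Fin n) (r : RandSeq) : Part (G.Action i) :=
  (p i).eval θ r (encodeProfile p) >>= fun x => ⟨x < G.numActions i, fun h => ⟨x, h⟩⟩

/-- The law of the input sequences: an independent i.i.d. `U[0,1]` sequence per program. -/
noncomputable def inputLaw (n : ℕ) : Measure (Fin n → RandSeq) :=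
  Measure.pi fun _ => seqLaw

/-- The programs almost surely halt against each other. -/
def AlmostSurelyHalt (p : Fin n → Code) : Prop :=
  ∀ᵐ ω ∂(inputLaw n), ∀ i, (apply G θ p i (ω i)).Dom

/-- The probability that the programs output the action profile `a`. -/
noncomputable def outcomeProb (p : Fin n → Code) (a : G.Profile) : ℝ :=
  (inputLaw n).real {ω | ∀ i, a i ∈ apply G θ p i (ω i)}

/-- The expected utility of player `i` in the program game (meaningful for profiles that almost
surely halt). -/
noncomputable def programUtility (p : Fin n → Code) (i : Fin n) : ℝ :=
  ∑ a : G.Profile, outcomeProb G θ p a * G.utility i a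

/-- The strategy of program `i` in the profile `p`: the distribution of its output action. -/
noncomputable def inducedStrategy (p : Fin n → Code) (i : Fin n) (b : G.Action i) : ℝ :=
  (inputLaw n).real {ω | b ∈ apply G θ p i (ω i)}

/-- Program equilibrium: the programs almost surely halt against each other, and no player has a
better program among those that almost surely halt against the opponents' programs. -/
def IsProgramEquilibrium (p : Fin n → Code) : Prop :=
  AlmostSurelyHalt G θ p ∧
    ∀ (i : Fin n) (p' : Code), AlmostSurelyHalt G θ (Function.update p i p') →
      programUtility G θ (Function.update p i p') i ≤ programUtility G θ p i

/-! ### Uncorrelated ε-grounded π-bots -/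

/-- Policies of player `i`: from an action history `a^1, …, a^T` (here indexed by `Fin T`) and
`r_0, …, r_T` to an action. -/
abbrev Policy (i : Fin n) : Type :=
  ∀ T : ℕ, (Fin T → G.Profile) → (Fin (T + 1) → unitInterval) → G.Action i

open Classical in
/-- `min {t : r_t < ε}`; the search does not terminate if there is no such `t`. -/
noncomputable def timeStep (ε : ℝ) (r : RandSeq) : Part ℕ :=
  ⟨∃ t, (r t : ℝ) < ε, fun h => Nat.find h⟩

/-- The result of the algorithm: compute `T = min {t : r_t < ε}`, simulate for `t = 1, …, T` all
programs `j` on the tail `(r_m)_{m ≥ T+1-t}` (the index `t` below is shifted by one), and return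
the policy's answer to this history. It is undefined if the search or a simulation
does not halt. -/
noncomputable def groundedOutput (i : Fin n) (ε : ℝ) (π : Policy G i) (p : Fin n → Code)
    (r : RandSeq) : Part (G.Action i) :=
  (timeStep ε r).bind fun T =>
    ⟨∀ (t : Fin T) (j : Fin n), (apply G θ p j (r.drop (T - t))).Dom,
      fun h => π T (fun t j => (apply G θ p j (r.drop (T - t))).get (h t j)) fun m => r m⟩

/-- The program `c` of player `i` is an uncorrelated ε-grounded π-bot: against all opponents it
almost surely does what the algorithm prescribes. -/
def IsGroundedBot (i : Fin n) (ε : ℝ) (π : Policy G i) (c : Code) : Prop :=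
  0 < ε ∧ ∀ p : Fin n → Code, p i = c →
    ∀ᵐ r ∂seqLaw, apply G θ p i r = groundedOutput G θ i ε π p r

end ProgramGame

end ProgramGames

namespace ProgramGames
open MeasureTheory

/-! Each program reads only its own independent sequence, so outcomes are product distributions and
`v i = u_i(s)`. For the lower bound, let `S' j a` be the strategy that `p j` plays when player `i`
submits the constant program `a`. It suffices that, for these punishments, no pair `(q, s')` gives
player `i` more than `v i`; compactness then provides the minimum and the maximum.

Given `q` and `s'`, player `i` deviates as follows. Choose `δ = 1 / (E + 1)` below every `ε k`, let
`m` be the first index with `r m < δ`, and let `r (m + 1)` decide between playing some `a` (total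
weight `q`) and imitating `p i` on the original source codes. A grounded bot stops its search at
some `T ≤ m`, so every nested simulation runs on a tail starting at most at `m`. On all these tails
the first entry below `δ` is the same one, hence every simulated copy of the deviation makes the
same choice: the play is exactly that of the profile with constant program `a`, or that of `p`
(`ae_deviationPlay_eq`). The play of each of those profiles depends only on entries up to `m`
(`ae_apply_local`), so it is independent of `r (m + 1)`, and every player's strategy becomes the
required mixture (`inducedStrategy_deviationPlay`). Programs realize rational weights; real weights
follow by continuity (`mixedUtility_mixture_le`). -/

instance : IsProbabilityMeasure seqLaw := by unfold seqLaw; infer_instance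

instance (n : ℕ) : IsProbabilityMeasure (inputLaw n) := by unfold inputLaw; infer_instance

/-! ### The law of the input sequences: shifts, resampling of one entry, small entries -/

theorem seqLaw_pi {s : Finset ℕ} {t : ℕ → Set unitInterval} (ht : ∀ i, MeasurableSet (t i)) :
    seqLaw (Set.pi s t) = ∏ i ∈ s, volume (t i) :=
  Measure.infinitePi_pi _ fun i _ => ht i

theorem eq_seqLaw {ν : Measure RandSeq}
    (h : ∀ (s : Finset ℕ) (t : ℕ → Set unitInterval), (∀ i, MeasurableSet (t i)) →
      ν (Set.pi s t) = ∏ i ∈ s, volume (t i)) : ν = seqLaw :=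
  Measure.eq_infinitePi _ h

theorem measurePreserving_drop (k : ℕ) : MeasurePreserving (RandSeq.drop k) seqLaw seqLaw := by
  have hm : Measurable (RandSeq.drop k) := measurable_pi_lambda _ fun m => measurable_pi_apply _
  refine ⟨hm, eq_seqLaw fun s t ht => ?_⟩
  rw [Measure.map_apply hm (.pi s.countable_toSet fun i _ => ht i)]
  have : RandSeq.drop k ⁻¹' Set.pi s t =
      Set.pi (s.map (addLeftEmbedding k) : Finset ℕ) fun i => t (i - k) := by
    ext r; simp [RandSeq.drop, Set.mem_pi]
  rw [this, seqLaw_pi fun i => ht _]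
  simp

theorem measurePreserving_update (m : ℕ) :
    MeasurePreserving (fun x : RandSeq × unitInterval => Function.update x.1 m x.2)
      (seqLaw.prod volume) seqLaw := by
  have hm : Measurable fun x : RandSeq × unitInterval => Function.update x.1 m x.2 := by
    refine measurable_pi_lambda _ fun k => ?_
    by_cases hk : k = m
    · subst hk; simpa using measurable_snd
    · simp only [Function.update_of_ne hk]
      exact (measurable_pi_apply k).comp measurable_fst
  refine ⟨hm, eq_seqLaw fun s t ht => ?_⟩
  rw [Measure.map_apply hm (.pi s.countable_toSet fun i _ => ht i)]
  by_cases hs : m ∈ s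
  · have : (fun x : RandSeq × unitInterval => Function.update x.1 m x.2) ⁻¹' Set.pi s t =
        Set.pi (s.erase m : Finset ℕ) t ×ˢ t m := by
      ext ⟨r, u⟩
      simp only [Set.mem_preimage, Set.mem_pi, Finset.mem_coe, Set.mem_prod, Finset.mem_erase]
      refine ⟨fun h => ⟨fun i hi => by simpa [hi.1] using h i hi.2, by simpa using h m hs⟩,
        fun h i hi => ?_⟩
      by_cases him : i = m
      · subst him; simpa using h.2
      · simpa [him] using h.1 i ⟨him, hi⟩
    rw [this, Measure.prod_prod, seqLaw_pi ht, Finset.prod_erase_mul _ _ hs]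
  · have : (fun x : RandSeq × unitInterval => Function.update x.1 m x.2) ⁻¹' Set.pi s t =
        Set.pi (s : Set ℕ) t ×ˢ Set.univ := by
      ext ⟨r, u⟩
      simp only [Set.mem_preimage, Set.mem_pi, Finset.mem_coe, Set.mem_prod, Set.mem_univ,
        and_true]
      refine forall₂_congr fun i hi => ?_
      rw [Function.update_of_ne (ne_of_mem_of_not_mem (Finset.mem_coe.1 hi) hs)]
    rw [this, Measure.prod_prod, seqLaw_pi ht, measure_univ, mul_one]

/-- An event that almost surely does not depend on `r_m` is independent of `r_m`. -/
theorem seqLaw_inter_coord {m : ℕ} {E : Set RandSeq} {D : Set unitInterval}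
    (hE : MeasurableSet E) (hD : MeasurableSet D) {Q : RandSeq → Prop} (hQ : ∀ᵐ r ∂seqLaw, Q r)
    (h : ∀ r r', Q r → Q r' → (∀ t, t ≠ m → r t = r' t) → r ∈ E → r' ∈ E) :
    seqLaw (E ∩ {r | r m ∈ D}) = seqLaw E * volume D := by
  have hmp := measurePreserving_update m
  have hmD : MeasurableSet {r : RandSeq | r m ∈ D} := measurable_pi_apply m hD
  -- Replace `r m` by an independent uniform entry. Up to a null set the event becomes a product
  -- set, because `Q` holds almost surely both before and after resampling.
  rw [← hmp.measure_preimage (hE.inter hmD).nullMeasurableSet, ← Measure.prod_prod]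
  refine measure_congr ?_
  have h1 : ∀ᵐ x ∂(seqLaw.prod (volume : Measure unitInterval)), Q x.1 :=
    Measure.quasiMeasurePreserving_fst.ae hQ
  have h2 := hmp.quasiMeasurePreserving.ae hQ
  filter_upwards [h1, h2] with x hx1 hx2
  refine propext ?_
  change (Function.update x.1 m x.2 ∈ E ∧ Function.update x.1 m x.2 m ∈ D) ↔ x.1 ∈ E ∧ x.2 ∈ D
  rw [Function.update_self]
  exact and_congr_left fun _ => ⟨h _ _ hx2 hx1 fun t ht => by simp [ht],
    h _ _ hx1 hx2 fun t ht => by simp [ht]⟩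

theorem volume_unitInterval_Ico {c d : ℝ} (hc : 0 ≤ c) (hd : d ≤ 1) :
    volume {u : unitInterval | c ≤ u ∧ (u : ℝ) < d} = ENNReal.ofReal (d - c) := by
  rw [unitInterval.volume_apply, ← Real.volume_Ico]
  congr 1
  ext x
  simp only [Set.mem_image, Set.mem_ofPred_eq, Subtype.exists, Set.mem_Ico, Set.mem_Icc]
  constructor
  · rintro ⟨y, hy, h, rfl⟩; exact h
  · intro h; exact ⟨x, ⟨hc.trans h.1, (h.2.trans_le hd).le⟩, h, rfl⟩

theorem volume_unitInterval_Ici {c : ℝ} (hc : 0 ≤ c) :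
    volume {u : unitInterval | c ≤ u} = ENNReal.ofReal (1 - c) := by
  rw [unitInterval.volume_apply, ← Real.volume_Icc]
  congr 1
  ext x
  simp only [Set.mem_image, Set.mem_ofPred_eq, Subtype.exists, Set.mem_Icc]
  constructor
  · rintro ⟨y, hy, h, rfl⟩; exact ⟨h, hy.2⟩
  · intro h; exact ⟨x, ⟨hc.trans h.1, h.2⟩, h.1, rfl⟩

theorem ae_exists_lt {ε : ℝ} (hε : 0 < ε) : ∀ᵐ r ∂seqLaw, ∃ m, (r m : ℝ) < ε := by
  set D : Set unitInterval := {u | ε ≤ u}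
  have hD : MeasurableSet D := measurableSet_le measurable_const measurable_subtype_coe
  have hlt : volume D < 1 := by
    rw [volume_unitInterval_Ici hε.le, ENNReal.ofReal_lt_one]; linarith
  rw [ae_iff]
  refine le_antisymm (ge_of_tendsto' (ENNReal.tendsto_pow_atTop_nhds_zero_of_lt_one hlt)
    fun N => ?_) zero_le
  calc seqLaw {r | ¬∃ m, (r m : ℝ) < ε}
      ≤ seqLaw (Set.pi (Finset.range N : Finset ℕ) fun _ => D) := by
        refine measure_mono fun r hr m _ => ?_
        simp only [Set.mem_ofPred_eq, not_exists, not_lt] at hr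
        exact hr m
    _ = volume D ^ N := by rw [seqLaw_pi fun _ => hD]; simp

/-- Simulations run on tails, so almost sure identities are needed on all tails at once. -/
theorem ae_drop {Q : RandSeq → Prop} (h : ∀ᵐ r ∂seqLaw, Q r) :
    ∀ᵐ r ∂seqLaw, ∀ k, Q (r.drop k) :=
  ae_all_iff.2 fun k => (measurePreserving_drop k).quasiMeasurePreserving.ae h

theorem RandSeq.drop_drop (k l : ℕ) (r : RandSeq) : (r.drop k).drop l = r.drop (k + l) := by
  funext m; simp [RandSeq.drop, add_assoc]

theorem RandSeq.drop_zero (r : RandSeq) : r.drop 0 = r := by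
  funext m; simp [RandSeq.drop]

/-! ### Measurability of program outputs -/

/-- Intermediate results are natural numbers, so each constructor combines the events of its parts
by countable unions and intersections. -/
theorem Code.measurableSet_eval (θ : ℕ → ℝ) (c : Code) (x y : ℕ) :
    MeasurableSet {r : RandSeq | y ∈ c.eval θ r x} := by
  have hlt : ∀ (m : ℕ) (d : ℝ), MeasurableSet {r : RandSeq | (r m : ℝ) < d} := fun m d =>
    measurableSet_lt (measurable_subtype_coe.comp (measurable_pi_apply m)) measurable_const
  have hite : ∀ (m : ℕ) (d : ℝ) (y : ℕ),
      MeasurableSet {r : RandSeq | y = if (r m : ℝ) < d then 1 else 0} := by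
    intro m d y
    have : {r : RandSeq | y = if (r m : ℝ) < d then 1 else 0} =
        ({r | (r m : ℝ) < d} ∩ {_r | y = 1}) ∪ ({r | (r m : ℝ) < d}ᶜ ∩ {_r | y = 0}) := by
      ext r
      by_cases h : (r m : ℝ) < d <;> simp [h]
    rw [this]
    exact ((hlt m d).inter (.const _)).union ((hlt m d).compl.inter (.const _))
  induction c generalizing x y with
  | zero | succ | left | right =>
    simp only [Code.eval, Part.mem_some_iff]
    exact .const _
  | ltRat => simpa [Code.eval] using hite _ _ _
  | ltConst => simpa [Code.eval] using hite _ _ _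
  | pair f g hf hg =>
    have : {r : RandSeq | y ∈ (pair f g).eval θ r x} =
        ⋃ a, ⋃ b, {r | a ∈ f.eval θ r x} ∩ {r | b ∈ g.eval θ r x} ∩ {_r | Nat.pair a b = y} := by
      ext r
      simp [Code.eval, Seq.seq, and_assoc]
    rw [this]
    exact .iUnion fun a => .iUnion fun b => ((hf x a).inter (hg x b)).inter (.const _)
  | comp f g hf hg =>
    have : {r : RandSeq | y ∈ (comp f g).eval θ r x} =
        ⋃ a, {r | a ∈ g.eval θ r x} ∩ {r | y ∈ f.eval θ r a} := by
      ext r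
      simp only [Set.mem_iUnion, Set.mem_inter_iff]
      exact Part.mem_bind_iff
    rw [this]
    exact .iUnion fun a => (hg x a).inter (hf a y)
  | prec f g hf hg =>
    simp only [Code.eval, Nat.unpaired]
    generalize x.unpair.1 = a
    generalize x.unpair.2 = k
    induction k generalizing y with
    | zero => exact hf a y
    | succ k ih =>
      simp only [Part.bind_eq_bind, Part.mem_bind_iff, Set.ofPred_exists]
      exact .iUnion fun i => (ih i).inter (hg _ y)
  | rfind' f hf =>
    simp only [Code.eval, Nat.unpaired]
    generalize x.unpair.1 = a
    generalize x.unpair.2 = m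
    have : {r : RandSeq | y ∈ (Nat.rfind fun k =>
          (fun y => decide (y = 0)) <$> f.eval θ r (Nat.pair a (k + m))).map (· + m)} =
        ⋃ k, ({r | 0 ∈ f.eval θ r (Nat.pair a (k + m))} ∩
          ⋂ j, ⋂ (_ : j < k), ⋃ z, {r | z ∈ f.eval θ r (Nat.pair a (j + m))} ∩ {_r | z ≠ 0}) ∩
          {_r | k + m = y} := by
      ext r
      simp only [Part.mem_map_iff, Set.mem_iUnion, Set.mem_inter_iff, Set.mem_iInter]
      refine exists_congr fun k => and_congr_left fun _ => Nat.mem_rfind.trans ?_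
      simp
    rw [this]
    exact .iUnion fun k => ((hf _ _).inter (.iInter fun j => .iInter fun _ => .iUnion fun z =>
      (hf _ _).inter (.const _))).inter (.const _)

variable {n : ℕ} {G : Game n} {θ : ℕ → ℝ}

theorem measurableSet_mem_apply (p : Fin n → Code) (i : Fin n) (b : G.Action i) :
    MeasurableSet {r | b ∈ apply G θ p i r} := by
  have : {r | b ∈ apply G θ p i r} = {r | (b : ℕ) ∈ (p i).eval θ r (encodeProfile p)} := by
    ext r
    simp only [apply, Set.mem_ofPred_eq, Part.bind_eq_bind, Part.mem_bind_iff]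
    constructor
    · rintro ⟨x, hx, h, rfl⟩; exact hx
    · intro h; exact ⟨b, h, b.2, rfl⟩
  rw [this]
  exact Code.measurableSet_eval θ _ _ _

/-! ### Grounded programs only look at the input up to the first small entry -/

theorem timeStep_eq_some {ε : ℝ} {r : RandSeq} {T : ℕ} (hT : (r T : ℝ) < ε)
    (hlt : ∀ t < T, ε ≤ r t) : timeStep ε r = Part.some T := by
  refine Part.eq_some_iff.2 ⟨⟨T, hT⟩, ?_⟩
  exact (Nat.find_eq_iff _).2 ⟨hT, fun t ht => not_lt.2 (hlt t ht)⟩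

theorem exists_first {ε : ℝ} {r : RandSeq} {N : ℕ} (hN : (r N : ℝ) < ε) :
    ∃ T ≤ N, (r T : ℝ) < ε ∧ ∀ t < T, ε ≤ r t := by
  classical
  have h : ∃ N, (r N : ℝ) < ε := ⟨N, hN⟩
  exact ⟨Nat.find h, Nat.find_min' h hN, Nat.find_spec h, fun t ht => not_lt.1 (Nat.find_min h ht)⟩

/-- The search stops at some `T ≤ N`, so only entries up to `N` and the tails starting at `1, …, N`
matter. -/
theorem groundedOutput_congr {k : Fin n} {ε : ℝ} {π : Policy G k} {P P' : Fin n → Code}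
    {r r' : RandSeq} {N : ℕ} (hN : (r N : ℝ) < ε) (hr : ∀ t ≤ N, r t = r' t)
    (h : ∀ t, 1 ≤ t → t ≤ N → ∀ j, apply G θ P j (r.drop t) = apply G θ P' j (r'.drop t)) :
    groundedOutput G θ k ε π P r = groundedOutput G θ k ε π P' r' := by
  obtain ⟨T, hTN, hT, hlt⟩ := exists_first hN
  have h1 := timeStep_eq_some hT hlt
  have h2 : timeStep ε r' = Part.some T := timeStep_eq_some (hr T hTN ▸ hT) fun t ht =>
    hr t (ht.le.trans hTN) ▸ hlt t ht
  rw [groundedOutput, groundedOutput, h1, h2, Part.bind_some, Part.bind_some]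
  have hF : (fun (t : Fin T) j => apply G θ P j (r.drop (T - t))) =
      fun (t : Fin T) j => apply G θ P' j (r'.drop (T - t)) := by
    funext t j
    exact h _ (by omega) (by omega) j
  have hρ : (fun m : Fin (T + 1) => r m) = fun m : Fin (T + 1) => r' m := by
    funext m
    exact hr m (by omega)
  exact congrArg₂ (fun (F : Fin T → ∀ j, Part (G.Action j)) ρ =>
    (⟨∀ t j, (F t j).Dom, fun h => π T (fun t j => (F t j).get (h t j)) ρ⟩ : Part (G.Action k)))
    hF hρ

theorem groundedOutput_dom {k : Fin n} {ε : ℝ} {π : Policy G k} {P : Fin n → Code}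
    {r : RandSeq} {N : ℕ} (hN : (r N : ℝ) < ε)
    (h : ∀ t, 1 ≤ t → t ≤ N → ∀ j, (apply G θ P j (r.drop t)).Dom) :
    (groundedOutput G θ k ε π P r).Dom := by
  obtain ⟨T, hTN, hT, hlt⟩ := exists_first hN
  rw [groundedOutput, timeStep_eq_some hT hlt, Part.bind_some]
  exact fun t j => h _ (by omega) (by omega) j

/-- Two profiles behave alike on all tails of inputs that agree up to a small entry `r_m`, if each
player's programs do so or are grounded bots with the same parameters. -/
theorem apply_drop_congr {P P' : Fin n → Code} {r r' : RandSeq} {m : ℕ} {δ : ℝ}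
    (hm : (r m : ℝ) < δ) (hr : ∀ t ≤ m, r t = r' t)
    (h : ∀ k, (∀ l ≤ m, apply G θ P k (r.drop l) = apply G θ P' k (r'.drop l)) ∨
      ∃ (ε : ℝ) (π : Policy G k), δ ≤ ε ∧
        (∀ l ≤ m, apply G θ P k (r.drop l) = groundedOutput G θ k ε π P (r.drop l)) ∧
        ∀ l ≤ m, apply G θ P' k (r'.drop l) = groundedOutput G θ k ε π P' (r'.drop l))
    {l : ℕ} (hl : l ≤ m) (k : Fin n) :
    apply G θ P k (r.drop l) = apply G θ P' k (r'.drop l) := by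
  -- Simulated tails start strictly later but never after `m`, so `m - l` bounds the depth of the
  -- recursion.
  obtain ⟨d, hd⟩ : ∃ d, m - l = d := ⟨_, rfl⟩
  induction d using Nat.strong_induction_on generalizing l k with
  | _ d ih =>
    rcases h k with h | ⟨ε, π, hε, h1, h2⟩
    · exact h l hl
    · rw [h1 l hl, h2 l hl]
      refine groundedOutput_congr (N := m - l) ?_ (fun t ht => hr _ (by omega)) fun t ht1 ht2 j => ?_
      · simp only [RandSeq.drop, Nat.add_sub_cancel' hl]
        linarith
      · rw [RandSeq.drop_drop, RandSeq.drop_drop]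
        exact ih (m - (l + t)) (by omega) (by omega) j rfl

theorem apply_drop_dom {P : Fin n → Code} {r : RandSeq} {m : ℕ} {δ : ℝ}
    (hm : (r m : ℝ) < δ)
    (h : ∀ k, (∀ l ≤ m, (apply G θ P k (r.drop l)).Dom) ∨
      ∃ (ε : ℝ) (π : Policy G k), δ ≤ ε ∧
        ∀ l ≤ m, apply G θ P k (r.drop l) = groundedOutput G θ k ε π P (r.drop l))
    {l : ℕ} (hl : l ≤ m) (k : Fin n) : (apply G θ P k (r.drop l)).Dom := by
  obtain ⟨d, hd⟩ : ∃ d, m - l = d := ⟨_, rfl⟩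
  induction d using Nat.strong_induction_on generalizing l k with
  | _ d ih =>
    rcases h k with h | ⟨ε, π, hε, h1⟩
    · exact h l hl
    · rw [h1 l hl]
      refine groundedOutput_dom (N := m - l) ?_ fun t ht1 ht2 j => ?_
      · simp only [RandSeq.drop, Nat.add_sub_cancel' hl]
        linarith
      · rw [RandSeq.drop_drop]
        exact ih (m - (l + t)) (by omega) (by omega) j rfl

/-! ### Code constructions -/

namespace Code

/-- Code of a constant function. -/
def const : ℕ → Code
  | 0 => zero
  | k + 1 => comp succ (const k)

/-- Code that on input `x` behaves like `f` if `c` returns `1` on `x`, and like `g` if it returns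
`0`. -/
def ite (c f g : Code) : Code :=
  comp (prec g (comp f left)) (pair (pair left right) c)

/-- Code that returns the index of the first entry of the random input below `1 / (E + 1)`. -/
def firstSmall (E : ℕ) : Code :=
  comp (rfind' (ite (comp ltRat (pair right (const (Nat.pair 1 E)))) (const 0) (const 1)))
    (const 0)

/-- Code that tests whether the entry after the first one below `1 / (E + 1)` is less than
`N / (D + 1)`. -/
def testNext (E D N : ℕ) : Code :=
  comp ltRat (pair (comp succ (firstSmall E)) (const (Nat.pair N D)))

/-- Code that returns the first `a < A` such that `C (a + 1) / (D + 1)` exceeds the tested entry,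
if there is one. -/
def select (E D : ℕ) (C : ℕ → ℕ) : ℕ → Code
  | 0 => const 0
  | a + 1 => ite (testNext E D (C a)) (select E D C a) (const a)

/-- Code that selects one of the actions `0, …, A - 1` if the tested entry is less than
`C A / (D + 1)`, and behaves like `c` on input `x` otherwise. -/
def deviation (E D : ℕ) (C : ℕ → ℕ) (A : ℕ) (c : Code) (x : ℕ) : Code :=
  ite (testNext E D (C A)) (select E D C A) (comp c (const x))

variable {θ : ℕ → ℝ} {r : RandSeq}

theorem eval_comp_some {f g : Code} {x y : ℕ} (h : g.eval θ r x = Part.some y) :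
    (comp f g).eval θ r x = f.eval θ r y := by
  simp only [eval, h]
  exact Part.bind_some _ _

theorem eval_pair_some {f g : Code} {x y z : ℕ} (hf : f.eval θ r x = Part.some y)
    (hg : g.eval θ r x = Part.some z) :
    (pair f g).eval θ r x = Part.some (Nat.pair y z) := by
  simp [eval, hf, hg, Seq.seq]

theorem eval_const (k x : ℕ) : (const k).eval θ r x = Part.some k := by
  induction k with
  | zero => rfl
  | succ k ih => rw [const, eval_comp_some ih]; rfl

theorem eval_ite_aux {c f g : Code} {x k : ℕ} (h : c.eval θ r x = Part.some k) :
    (ite c f g).eval θ r x = (prec g (comp f left)).eval θ r (Nat.pair x k) := by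
  have h1 : (pair left right).eval θ r x = Part.some x := by
    rw [eval_pair_some (y := x.unpair.1) (z := x.unpair.2) rfl rfl, Nat.pair_unpair]
  exact eval_comp_some (eval_pair_some h1 h)

theorem eval_ite_zero {c f g : Code} {x : ℕ} (h : c.eval θ r x = Part.some 0) :
    (ite c f g).eval θ r x = g.eval θ r x := by
  rw [eval_ite_aux h]
  simp [eval]

/-- `prec` evaluates its base case `g` first, so `g` has to halt even when `f` is selected. -/
theorem eval_ite_one {c f g : Code} {x : ℕ} (h : c.eval θ r x = Part.some 1)
    (hg : (g.eval θ r x).Dom) : (ite c f g).eval θ r x = f.eval θ r x := by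
  obtain ⟨y, hy⟩ := Part.dom_iff_mem.1 hg
  rw [eval_ite_aux h]
  simp [eval, Part.eq_some_iff.2 hy]
  exact Part.bind_some _ _

theorem eval_firstSmall {E m : ℕ} (hm : (r m : ℝ) < 1 / ((E : ℝ) + 1))
    (hlt : ∀ t < m, 1 / ((E : ℝ) + 1) ≤ r t) (x : ℕ) :
    (firstSmall E).eval θ r x = Part.some m := by
  rw [firstSmall, eval_comp_some (eval_const 0 x)]
  set c := ite (comp ltRat (pair right (const (Nat.pair 1 E)))) (const 0) (const 1) with hc
  have hq : ∀ k, (comp ltRat (pair right (const (Nat.pair 1 E)))).eval θ r (Nat.pair 0 k) =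
      Part.some (if (r k : ℝ) < 1 / ((E : ℝ) + 1) then 1 else 0) := by
    intro k
    rw [eval_comp_some (eval_pair_some (y := k) (by simp [eval]) (eval_const _ _))]
    simp [eval]
  -- `rfind'` searches for a zero, hence the inverted truth values.
  have h0 : c.eval θ r (Nat.pair 0 m) = Part.some 0 := by
    rw [hc, eval_ite_one (by rw [hq, if_pos hm]) (by rw [eval_const]; trivial), eval_const]
  have h1 : ∀ t < m, c.eval θ r (Nat.pair 0 t) = Part.some 1 := by
    intro t ht
    rw [hc, eval_ite_zero (by rw [hq, if_neg (not_lt.2 (hlt t ht))]), eval_const]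
  simp only [eval, Nat.unpaired, Nat.unpair_zero, Prod.fst_zero, Prod.snd_zero, add_zero]
  refine Part.eq_some_iff.2 ((Part.mem_map_iff _).2 ⟨m, Nat.mem_rfind.2 ⟨?_, fun {t} ht => ?_⟩, rfl⟩)
  · simp [h0]
  · simp [h1 t ht]

theorem eval_testNext {E D N m : ℕ} (hm : (r m : ℝ) < 1 / ((E : ℝ) + 1))
    (hlt : ∀ t < m, 1 / ((E : ℝ) + 1) ≤ r t) (x : ℕ) [Decidable ((r (m + 1) : ℝ) < N / ((D : ℝ) + 1))] :
    (testNext E D N).eval θ r x =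
      Part.some (if (r (m + 1) : ℝ) < N / ((D : ℝ) + 1) then 1 else 0) := by
  have h : (comp succ (firstSmall E)).eval θ r x = Part.some (m + 1) := by
    rw [eval_comp_some (eval_firstSmall hm hlt x)]; rfl
  rw [testNext, eval_comp_some (eval_pair_some h (eval_const _ _))]
  simp [eval]

/-- Thresholds are tested from the top down: by monotonicity those with index above `a` exceed the
entry, and the one with index `a` is the first that does not. -/
theorem eval_select {E D m : ℕ} {C : ℕ → ℕ} (hC : Monotone C)
    (hm : (r m : ℝ) < 1 / ((E : ℝ) + 1)) (hlt : ∀ t < m, 1 / ((E : ℝ) + 1) ≤ r t) (x : ℕ)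
    {A a : ℕ} (ha : a < A) (h1 : (C a : ℝ) / ((D : ℝ) + 1) ≤ r (m + 1))
    (h2 : (r (m + 1) : ℝ) < C (a + 1) / ((D : ℝ) + 1)) :
    (select E D C A).eval θ r x = Part.some a := by
  classical
  induction A with
  | zero => omega
  | succ A ih =>
    have hd : ((const A).eval θ r x).Dom := by rw [eval_const]; trivial
    rcases (Nat.lt_succ_iff.1 ha).lt_or_eq with h | rfl
    · have : (r (m + 1) : ℝ) < C A / ((D : ℝ) + 1) :=
        h2.trans_le (by have : C (a + 1) ≤ C A := hC h; gcongr)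
      rw [select, eval_ite_one (by rw [eval_testNext hm hlt, if_pos this]) hd, ih h]
    · rw [select, eval_ite_zero (by rw [eval_testNext hm hlt, if_neg (not_lt.2 h1)]), eval_const]

theorem eval_deviation_of_lt {E D m : ℕ} {C : ℕ → ℕ} (hC : Monotone C) {c : Code} {x₀ : ℕ}
    (hm : (r m : ℝ) < 1 / ((E : ℝ) + 1)) (hlt : ∀ t < m, 1 / ((E : ℝ) + 1) ≤ r t)
    (hc : (c.eval θ r x₀).Dom) (x : ℕ)
    {A a : ℕ} (ha : a < A) (h1 : (C a : ℝ) / ((D : ℝ) + 1) ≤ r (m + 1))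
    (h2 : (r (m + 1) : ℝ) < C (a + 1) / ((D : ℝ) + 1)) :
    (deviation E D C A c x₀).eval θ r x = Part.some a := by
  classical
  have : (r (m + 1) : ℝ) < C A / ((D : ℝ) + 1) :=
    h2.trans_le (by have : C (a + 1) ≤ C A := hC ha; gcongr)
  rw [deviation, eval_ite_one (by rw [eval_testNext hm hlt, if_pos this])
    (by rwa [eval_comp_some (eval_const _ _)]), eval_select hC hm hlt x ha h1 h2]

theorem eval_deviation_of_le {E D m : ℕ} {C : ℕ → ℕ} {c : Code} {x₀ : ℕ}
    (hm : (r m : ℝ) < 1 / ((E : ℝ) + 1)) (hlt : ∀ t < m, 1 / ((E : ℝ) + 1) ≤ r t)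
    (x : ℕ) {A : ℕ} (h : (C A : ℝ) / ((D : ℝ) + 1) ≤ r (m + 1)) :
    (deviation E D C A c x₀).eval θ r x = c.eval θ r x₀ := by
  classical
  rw [deviation, eval_ite_zero (by rw [eval_testNext hm hlt, if_neg (not_lt.2 h)]),
    eval_comp_some (eval_const _ _)]

end Code

section Strategies

variable {n : ℕ} {G : Game n} {θ : ℕ → ℝ}

/-! ### Induced strategies -/

theorem inducedStrategy_eq (p : Fin n → Code) (k : Fin n) (b : G.Action k) :
    inducedStrategy G θ p k b = seqLaw.real {r | b ∈ apply G θ p k r} := by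
  classical
  have : {ω : Fin n → RandSeq | b ∈ apply G θ p k (ω k)} =
      Set.pi Set.univ (Function.update (fun _ => Set.univ) k {r | b ∈ apply G θ p k r}) := by
    ext ω
    simp only [Set.mem_ofPred_eq, Set.mem_univ_pi]
    constructor
    · intro h j
      by_cases hj : j = k
      · subst hj; simpa using h
      · simp [hj]
    · intro h; simpa using h k
  rw [inducedStrategy, Measure.real, this, inputLaw, Measure.pi_pi, Measure.real,
    Finset.prod_eq_single k]
  · simp
  · intro j _ hj; simp [hj]
  · simp

theorem outcomeProb_eq (p : Fin n → Code) (a : G.Profile) :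
    outcomeProb G θ p a = ∏ k, inducedStrategy G θ p k (a k) := by
  have : {ω : Fin n → RandSeq | ∀ i, a i ∈ apply G θ p i (ω i)} =
      Set.pi Set.univ fun i => {r | a i ∈ apply G θ p i r} := by
    ext ω; simp
  rw [outcomeProb, Measure.real, this, inputLaw, Measure.pi_pi, ENNReal.toReal_prod]
  simp only [inducedStrategy_eq, Measure.real]

theorem programUtility_eq (p : Fin n → Code) (i : Fin n) :
    programUtility G θ p i = G.mixedUtility i (inducedStrategy G θ p) := by
  simp only [programUtility, Game.mixedUtility, outcomeProb_eq, mul_comm]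

theorem inducedStrategy_mem {p : Fin n → Code} {k : Fin n}
    (h : ∀ᵐ r ∂seqLaw, (apply G θ p k r).Dom) :
    inducedStrategy G θ p k ∈ G.strategies k := by
  refine ⟨fun b => measureReal_nonneg, ?_⟩
  simp only [inducedStrategy_eq]
  rw [← measureReal_iUnion_fintype _ fun b => measurableSet_mem_apply p k b]
  · rw [measureReal_congr (t := Set.univ), probReal_univ]
    refine Filter.eventuallyEq_univ.2 ?_
    filter_upwards [h] with r hr
    obtain ⟨b, hb⟩ := Part.dom_iff_mem.1 hr
    exact Set.mem_iUnion.2 ⟨b, hb⟩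
  · intro b b' hbb'
    exact Set.disjoint_left.2 fun r hr hr' => hbb' (Part.mem_unique hr hr')

theorem almostSurelyHalt_of_ae {p : Fin n → Code}
    (h : ∀ k, ∀ᵐ r ∂seqLaw, (apply G θ p k r).Dom) : AlmostSurelyHalt G θ p :=
  ae_all_iff.2 fun k => (Measure.quasiMeasurePreserving_eval (fun _ => seqLaw) k).ae (h k)

end Strategies

/-! ### Decomposition of events -/

/-- The event that `r_m` is the first entry below `δ`. -/
def firstSmallEvent (δ : ℝ) (m : ℕ) : Set RandSeq := {r | (r m : ℝ) < δ ∧ ∀ t < m, δ ≤ r t}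

theorem measurableSet_firstSmallEvent (δ : ℝ) (m : ℕ) : MeasurableSet (firstSmallEvent δ m) := by
  have hr : ∀ t, Measurable fun r : RandSeq => (r t : ℝ) := fun t =>
    measurable_subtype_coe.comp (measurable_pi_apply t)
  refine (measurableSet_lt (hr m) measurable_const).inter ?_
  change MeasurableSet {r : RandSeq | ∀ t < m, δ ≤ r t}
  simp only [Set.ofPred_forall]
  exact .iInter fun t => .iInter fun _ => measurableSet_le measurable_const (hr t)

theorem firstSmallEvent_unique {δ : ℝ} {m m' : ℕ} {r : RandSeq} (h : r ∈ firstSmallEvent δ m)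
    (h' : r ∈ firstSmallEvent δ m') : m = m' := by
  rcases lt_trichotomy m m' with hlt | heq | hlt
  · exact absurd h.1 (not_lt.2 (h'.2 m hlt))
  · exact heq
  · exact absurd h'.1 (not_lt.2 (h.2 m' hlt))

theorem seqLaw_eq_tsum {δ : ℝ} (hδ : 0 < δ) {S : Set RandSeq} (hS : MeasurableSet S) :
    seqLaw S = ∑' m, seqLaw (S ∩ firstSmallEvent δ m) := by
  rw [← measure_iUnion _ fun m => hS.inter (measurableSet_firstSmallEvent δ m)]
  · refine measure_congr ?_
    filter_upwards [ae_exists_lt hδ] with r hr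
    obtain ⟨N, hN⟩ := hr
    obtain ⟨T, _, hT⟩ := exists_first hN
    refine propext ⟨fun h => Set.mem_iUnion.2 ⟨T, h, hT⟩, fun h => ?_⟩
    obtain ⟨m, hm⟩ := Set.mem_iUnion.1 h
    exact hm.1
  · intro m m' hmm'
    exact Set.disjoint_left.2 fun r hr hr' => hmm' (firstSmallEvent_unique hr.2 hr'.2)

/-- If the entry after the first small one decides which of the events `S o` the event `S`
coincides with, and the events `S o` do not depend on this entry, then the probability of `S` is
the corresponding mixture. -/
theorem seqLaw_eq_sum {δ : ℝ} (hδ : 0 < δ) {ι : Type*} [Fintype ι] {S : Set RandSeq}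
    (hS : MeasurableSet S) {S' : ι → Set RandSeq} (hS' : ∀ o, MeasurableSet (S' o))
    {R : ι → Set unitInterval} (hR : ∀ o, MeasurableSet (R o)) (hRex : ∀ u, ∃ o, u ∈ R o)
    (hRun : ∀ u o o', u ∈ R o → u ∈ R o' → o = o')
    (hSS' : ∀ᵐ r ∂seqLaw, ∀ m, r ∈ firstSmallEvent δ m → ∀ o, r (m + 1) ∈ R o →
      (r ∈ S ↔ r ∈ S' o))
    {Q : ι → RandSeq → Prop} (hQ : ∀ o, ∀ᵐ r ∂seqLaw, Q o r)
    (hloc : ∀ o r r' m, Q o r → Q o r' → (r m : ℝ) < δ → (∀ t ≤ m, r t = r' t) →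
      r ∈ S' o → r' ∈ S' o) :
    seqLaw S = ∑ o, volume (R o) * seqLaw (S' o) := by
  have hF := measurableSet_firstSmallEvent δ
  have key : ∀ m, seqLaw (S ∩ firstSmallEvent δ m) =
      ∑ o, volume (R o) * seqLaw (S' o ∩ firstSmallEvent δ m) := by
    intro m
    -- Both events on the left are determined, almost surely, by entries up to `m`, hence are
    -- independent of `r (m + 1)`.
    have h1 : ∀ o, volume (R o) * seqLaw (S' o ∩ firstSmallEvent δ m) =
        seqLaw ((S' o ∩ firstSmallEvent δ m) ∩ {r | r (m + 1) ∈ R o}) := by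
      intro o
      rw [mul_comm, seqLaw_inter_coord ((hS' o).inter (hF m)) (hR o) (hQ o)]
      rintro r r' hr hr' hag ⟨h1, h2⟩
      have hag' : ∀ t ≤ m, r t = r' t := fun t ht => hag t (by omega)
      exact ⟨hloc o r r' m hr hr' h2.1 hag' h1, hag' m le_rfl ▸ h2.1,
        fun t ht => hag' t ht.le ▸ h2.2 t ht⟩
    simp only [h1]
    rw [← tsum_fintype (L := .unconditional _), ← measure_iUnion]
    · refine measure_congr ?_
      filter_upwards [hSS'] with r hr
      refine propext ⟨fun h => ?_, fun h => ?_⟩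
      · obtain ⟨o, ho⟩ := hRex (r (m + 1))
        exact Set.mem_iUnion.2 ⟨o, ⟨(hr m h.2 o ho).1 h.1, h.2⟩, ho⟩
      · obtain ⟨o, ⟨h1, h2⟩, ho⟩ := Set.mem_iUnion.1 h
        exact ⟨(hr m h2 o ho).2 h1, h2⟩
    · intro o o' hoo'
      exact Set.disjoint_left.2 fun r hr hr' => hoo' (hRun _ o o' hr.2 hr'.2)
    · exact fun o => ((hS' o).inter (hF m)).inter (measurable_pi_apply (m + 1) (hR o))
  rw [seqLaw_eq_tsum hδ hS]
  simp only [key]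
  rw [Summable.tsum_finsetSum fun _ _ => ENNReal.summable]
  refine Finset.sum_congr rfl fun o _ => ?_
  rw [ENNReal.tsum_mul_left, ← seqLaw_eq_tsum hδ (hS' o)]

section Bots

variable {n : ℕ} {G : Game n} {θ : ℕ → ℝ} {p : Fin n → Code} {ε : Fin n → ℝ}
  {π : ∀ i, Policy G i}

/-! ### Profiles of grounded bots -/

theorem ae_apply_drop_eq (hbot : ∀ i, IsGroundedBot G θ i (ε i) (π i) (p i)) (P : Fin n → Code) :
    ∀ᵐ r ∂seqLaw, ∀ k, P k = p k → ∀ l,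
      apply G θ P k (r.drop l) = groundedOutput G θ k (ε k) (π k) P (r.drop l) := by
  refine ae_all_iff.2 fun k => ?_
  by_cases h : P k = p k
  · filter_upwards [ae_drop ((hbot k).2 P h)] with r hr _ using hr
  · exact .of_forall fun r h' => absurd h' h

/-- An entry below `δ` occurs almost surely and ends every chain of simulations. -/
theorem ae_apply_dom (hbot : ∀ i, IsGroundedBot G θ i (ε i) (π i) (p i)) {δ : ℝ} (hδ : 0 < δ)
    (hδε : ∀ k, δ ≤ ε k) {P : Fin n → Code}
    (hP : ∀ k, P k = p k ∨ ∀ r, (apply G θ P k r).Dom) :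
    ∀ᵐ r ∂seqLaw, ∀ k, (apply G θ P k r).Dom := by
  filter_upwards [ae_apply_drop_eq hbot P, ae_exists_lt hδ] with r hr ⟨m, hm⟩ k
  have := apply_drop_dom (G := G) (θ := θ) (P := P) hm (fun k => ?_) (Nat.zero_le m) k
  · rwa [RandSeq.drop_zero] at this
  · rcases hP k with h | h
    · exact .inr ⟨ε k, π k, hδε k, fun l _ => hr k h l⟩
    · exact .inl fun l _ => h _

/-- Grounded bots follow their algorithm only almost surely; `Q` is the event that they do so on all
tails. -/
theorem ae_apply_local (hbot : ∀ i, IsGroundedBot G θ i (ε i) (π i) (p i)) {δ : ℝ}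
    (hδε : ∀ k, δ ≤ ε k) {P : Fin n → Code}
    (hP : ∀ k, P k = p k ∨ ∀ r r', apply G θ P k r = apply G θ P k r') :
    ∃ Q : RandSeq → Prop, (∀ᵐ r ∂seqLaw, Q r) ∧ ∀ r r' m, Q r → Q r' → (r m : ℝ) < δ →
      (∀ t ≤ m, r t = r' t) → ∀ k, apply G θ P k r = apply G θ P k r' := by
  refine ⟨_, ae_apply_drop_eq hbot P, fun r r' m hr hr' hm hag k => ?_⟩
  have := apply_drop_congr (G := G) (θ := θ) (P := P) (P' := P) hm hag (fun k => ?_)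
    (Nat.zero_le m) k
  · rwa [RandSeq.drop_zero, RandSeq.drop_zero] at this
  · rcases hP k with h | h
    · exact .inr ⟨ε k, π k, hδε k, fun l _ => hr k h l, fun l _ => hr' k h l⟩
    · exact .inl fun l _ => h _ _

theorem apply_of_eval {P : Fin n → Code} {k : Fin n} {r : RandSeq} {a : G.Action k}
    (h : (P k).eval θ r (encodeProfile P) = Part.some (a : ℕ)) :
    apply G θ P k r = Part.some a := by
  rw [apply, h]
  refine (Part.bind_some _ _).trans ?_
  exact Part.eq_some_iff.2 ⟨a.2, rfl⟩

/-! ### Deviations -/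

/-- The profile in which player `i` always plays `a` (for `some a`), or the profile `p` itself. -/
def constProfile (p : Fin n → Code) (i : Fin n) : Option (G.Action i) → Fin n → Code
  | none => p
  | some a => Function.update p i (Code.const a)

/-- The entries for which the deviation program imitates `constProfile p i o`. -/
def deviationRegion (D : ℕ) (C : ℕ → ℕ) {A : ℕ} : Option (Fin A) → Set unitInterval
  | none => {u | (C A : ℝ) / ((D : ℝ) + 1) ≤ u}
  | some a => {u | (C a : ℝ) / ((D : ℝ) + 1) ≤ u ∧ (u : ℝ) < C (a + 1) / ((D : ℝ) + 1)}

/-- The deviation of player `i` that plays action `a` with weight `C (a + 1) - C a`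
(out of `D + 1`). -/
def deviationPlay (G : Game n) (p : Fin n → Code) (i : Fin n) (E D : ℕ) (C : ℕ → ℕ) :
    Fin n → Code :=
  Function.update p i (Code.deviation E D C (G.numActions i) (p i) (encodeProfile p))

theorem apply_constProfile_some (i : Fin n) (a : G.Action i) (r : RandSeq) :
    apply G θ (constProfile p i (some a)) i r = Part.some a := by
  refine apply_of_eval ?_
  rw [constProfile, Function.update_self, Code.eval_const]

theorem constProfile_cases (i : Fin n) (o : Option (G.Action i)) (k : Fin n) :
    constProfile p i o k = p k ∨
      ∃ a, ∀ r, apply G θ (constProfile p i o) k r = Part.some a := by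
  cases o with
  | none => exact .inl rfl
  | some a =>
    by_cases hk : k = i
    · subst hk; exact .inr ⟨a, apply_constProfile_some k a⟩
    · exact .inl (Function.update_of_ne hk _ _)

theorem ae_constProfile_dom (hbot : ∀ i, IsGroundedBot G θ i (ε i) (π i) (p i)) {δ : ℝ}
    (hδ : 0 < δ) (hδε : ∀ k, δ ≤ ε k) (i : Fin n) (o : Option (G.Action i)) :
    ∀ᵐ r ∂seqLaw, ∀ k, (apply G θ (constProfile p i o) k r).Dom :=
  ae_apply_dom hbot hδ hδε fun k => (constProfile_cases (θ := θ) i o k).imp_right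
    fun ⟨a, ha⟩ r => by rw [ha]; trivial

/-- The choice made from `r (m + 1)` is shared by all nested simulations, so the opponents respond
as if player `i` had submitted the chosen program. -/
theorem ae_deviationPlay_eq (hbot : ∀ i, IsGroundedBot G θ i (ε i) (π i) (p i)) (i : Fin n)
    {E : ℕ} (hE : ∀ k, 1 / ((E : ℝ) + 1) ≤ ε k) (D : ℕ) {C : ℕ → ℕ} (hC : Monotone C) :
    ∀ᵐ r ∂seqLaw, ∀ m, r ∈ firstSmallEvent (1 / ((E : ℝ) + 1)) m →
      ∀ o : Option (G.Action i), r (m + 1) ∈ deviationRegion D C o → ∀ k,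
        apply G θ (deviationPlay G p i E D C) k r = apply G θ (constProfile p i o) k r := by
  have hδ : 0 < 1 / ((E : ℝ) + 1) := by positivity
  have hconst : ∀ᵐ r ∂seqLaw, ∀ o : Option (G.Action i), ∀ k, constProfile p i o k = p k → ∀ l,
      apply G θ (constProfile p i o) k (r.drop l) =
        groundedOutput G θ k (ε k) (π k) (constProfile p i o) (r.drop l) :=
    ae_all_iff.2 fun o => ae_apply_drop_eq hbot _
  filter_upwards [ae_apply_drop_eq hbot (deviationPlay G p i E D C), hconst,
    ae_drop (ae_constProfile_dom hbot hδ hE i none)] with r hdev hconst hdom m hm o ho k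
  have := apply_drop_congr (G := G) (θ := θ) (P := deviationPlay G p i E D C)
    (P' := constProfile p i o) hm.1 (fun t _ => rfl) (fun k => ?_) (Nat.zero_le m) k
  · rwa [RandSeq.drop_zero] at this
  by_cases hk : k = i
  · subst hk
    -- On each tail from `l ≤ m` the first small entry is still `r m` and the tested entry is still
    -- `r (m + 1)`.
    refine .inl fun l hl => ?_
    have h1 : ((r.drop l (m - l) : unitInterval) : ℝ) < 1 / ((E : ℝ) + 1) := by
      simpa only [RandSeq.drop, Nat.add_sub_cancel' hl] using hm.1
    have h2 : ∀ t < m - l, 1 / ((E : ℝ) + 1) ≤ (r.drop l t : unitInterval) := fun t ht =>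
      hm.2 (l + t) (by omega)
    have h3 : r.drop l (m - l + 1) = r (m + 1) := by
      rw [RandSeq.drop, show l + (m - l + 1) = m + 1 by omega]
    have hd : ((p k).eval θ (r.drop l) (encodeProfile p)).Dom := (hdom l k).fst
    cases o with
    | none =>
      have ho : (C (G.numActions k) : ℝ) / ((D : ℝ) + 1) ≤ r (m + 1) := ho
      -- The deviation feeds `p k` the hard-coded codes of `p`, not its actual input; hence the
      -- exact agreement with `p`.
      rw [apply, deviationPlay, Function.update_self,
        Code.eval_deviation_of_le h1 h2 _ (by rwa [h3])]
      rfl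
    | some a =>
      rw [apply_constProfile_some]
      refine apply_of_eval ?_
      rw [deviationPlay, Function.update_self]
      exact Code.eval_deviation_of_lt hC h1 h2 hd _ a.2 (by rw [h3]; exact ho.1)
        (by rw [h3]; exact ho.2)
  · have h1 : deviationPlay G p i E D C k = p k := Function.update_of_ne hk _ _
    have h2 : constProfile p i o k = p k := by
      cases o with
      | none => rfl
      | some a => exact Function.update_of_ne hk _ _
    exact .inr ⟨ε k, π k, hE k, fun l _ => hdev k h1 l, fun l _ => hconst o k h2 l⟩

theorem deviationRegion_exists {D : ℕ} {C : ℕ → ℕ} (hC0 : C 0 = 0) {A : ℕ} (u : unitInterval) :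
    ∃ o : Option (Fin A), u ∈ deviationRegion D C o := by
  classical
  by_cases h : ∃ a, a < A ∧ (u : ℝ) < C (a + 1) / ((D : ℝ) + 1)
  · obtain ⟨ha, hu⟩ := Nat.find_spec h
    refine ⟨some ⟨Nat.find h, ha⟩, ?_, hu⟩
    change (C (Nat.find h) : ℝ) / ((D : ℝ) + 1) ≤ u
    rcases hf : Nat.find h with _ | a
    · simpa [hC0] using u.2.1
    · have := Nat.find_min h (m := a) (by omega)
      simp only [not_and, not_lt] at this
      exact this (by omega)
  · refine ⟨none, ?_⟩
    cases A with
    | zero => simpa [deviationRegion, hC0] using u.2.1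
    | succ A => exact not_lt.1 fun h' => h ⟨A, Nat.lt_succ_self A, h'⟩

theorem deviationRegion_unique {D : ℕ} {C : ℕ → ℕ} (hC : Monotone C) {A : ℕ} {u : unitInterval}
    {o o' : Option (Fin A)} (h : u ∈ deviationRegion D C o) (h' : u ∈ deviationRegion D C o') :
    o = o' := by
  have key : ∀ {a b : ℕ}, (u : ℝ) < C a / ((D : ℝ) + 1) → (C b : ℝ) / ((D : ℝ) + 1) ≤ u → b < a := by
    intro a b h1 h2
    by_contra hab
    have h3 : C a ≤ C b := hC (not_lt.1 hab)
    have h4 : (C a : ℝ) / ((D : ℝ) + 1) ≤ C b / ((D : ℝ) + 1) := by gcongr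
    linarith
  rcases o with _ | a <;> rcases o' with _ | b
  · rfl
  · have := key h'.2 h; omega
  · have := key h.2 h'; omega
  · have h1 := key h.2 h'.1
    have h2 := key h'.2 h.1
    exact congrArg some (Fin.ext (by omega))

theorem measurableSet_deviationRegion (D : ℕ) (C : ℕ → ℕ) {A : ℕ} (o : Option (Fin A)) :
    MeasurableSet (deviationRegion D C o) := by
  cases o with
  | none => exact measurableSet_le measurable_const measurable_subtype_coe
  | some a =>
    exact (measurableSet_le measurable_const measurable_subtype_coe).inter
      (measurableSet_lt measurable_subtype_coe measurable_const)

/-- The mixing weights are the lengths of the regions for the tested entry; `seqLaw_eq_sum` applies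
to every player's own sequence. -/
theorem inducedStrategy_deviationPlay (hbot : ∀ i, IsGroundedBot G θ i (ε i) (π i) (p i))
    (i : Fin n) {E : ℕ} (hE : ∀ k, 1 / ((E : ℝ) + 1) ≤ ε k) {D : ℕ} {C : ℕ → ℕ} (hC : Monotone C)
    (hC0 : C 0 = 0) (hCA : C (G.numActions i) ≤ D + 1) (k : Fin n) (b : G.Action k) :
    inducedStrategy G θ (deviationPlay G p i E D C) k b =
      (1 - C (G.numActions i) / ((D : ℝ) + 1)) * inducedStrategy G θ p k b +
      ∑ a : G.Action i, (C (a + 1) - C a : ℝ) / ((D : ℝ) + 1) *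
        inducedStrategy G θ (constProfile p i (some a)) k b := by
  have hloc := fun o : Option (G.Action i) => ae_apply_local hbot hE
    (P := constProfile p i o) fun k => (constProfile_cases (θ := θ) i o k).imp_right
      fun ⟨a, ha⟩ r r' => by rw [ha, ha]
  choose Q hQ hQloc using hloc
  have hCA' : (C (G.numActions i) : ℝ) ≤ (D : ℝ) + 1 := by exact_mod_cast hCA
  have hpos : (0 : ℝ) < (D : ℝ) + 1 := by positivity
  have key := seqLaw_eq_sum (δ := 1 / ((E : ℝ) + 1)) (by positivity)
    (S := {r | b ∈ apply G θ (deviationPlay G p i E D C) k r}) (measurableSet_mem_apply _ _ _)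
    (S' := fun o : Option (G.Action i) => {r | b ∈ apply G θ (constProfile p i o) k r})
    (fun o => measurableSet_mem_apply _ _ _) (R := deviationRegion D C)
    (measurableSet_deviationRegion D C) (deviationRegion_exists hC0)
    (fun u o o' => deviationRegion_unique hC) (by
      filter_upwards [ae_deviationPlay_eq hbot i hE D hC] with r hr m hm o ho
      simp only [hr m hm o ho k]) hQ
    (fun o r r' m hr hr' hm hag h => by
      simpa only [Set.mem_ofPred_eq, hQloc o r r' m hr hr' hm hag k] using h)
  simp only [inducedStrategy_eq, Measure.real, key]
  rw [ENNReal.toReal_sum fun o _ => by finiteness, Fintype.sum_option]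
  simp only [ENNReal.toReal_mul]
  congr 1
  · rw [deviationRegion, volume_unitInterval_Ici (by positivity), ENNReal.toReal_ofReal]
    · rfl
    · rw [sub_nonneg, div_le_one hpos]; exact hCA'
  · refine Finset.sum_congr rfl fun a _ => ?_
    have h1 : (C a : ℝ) ≤ C (a + 1) := by exact_mod_cast hC (Nat.le_succ _)
    have h2 : (C (a + 1) : ℝ) ≤ C (G.numActions i) := by exact_mod_cast hC a.2
    rw [deviationRegion, volume_unitInterval_Ico (by positivity), ENNReal.toReal_ofReal, sub_div]
    · rw [← sub_div]; exact div_nonneg (by linarith) hpos.le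
    · rw [div_le_one hpos]; linarith

theorem deviationPlay_halts (hbot : ∀ i, IsGroundedBot G θ i (ε i) (π i) (p i)) (i : Fin n)
    {E : ℕ} (hE : ∀ k, 1 / ((E : ℝ) + 1) ≤ ε k) (D : ℕ) {C : ℕ → ℕ} (hC : Monotone C)
    (hC0 : C 0 = 0) : AlmostSurelyHalt G θ (deviationPlay G p i E D C) := by
  have hδ : 0 < 1 / ((E : ℝ) + 1) := by positivity
  refine almostSurelyHalt_of_ae fun k => ?_
  filter_upwards [ae_deviationPlay_eq hbot i hE D hC, ae_exists_lt hδ,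
    ae_all_iff.2 fun o => ae_constProfile_dom hbot hδ hE i o] with r hr ⟨N, hN⟩ hdom
  obtain ⟨m, _, hm⟩ := exists_first hN
  obtain ⟨o, ho⟩ := deviationRegion_exists (D := D) hC0 (A := G.numActions i) (r (m + 1))
  rw [hr m hm o ho k]
  exact hdom o k

end Bots

/-! ### The minimum over punishments is attained -/

namespace Game

variable {n : ℕ} (G : Game n)

theorem continuous_mixedUtility (i : Fin n) : Continuous (G.mixedUtility i) := by
  unfold mixedUtility
  fun_prop

theorem continuous_deviationProfile (s : ∀ j, G.Action j → ℝ) (i : Fin n) :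
    Continuous fun x : (∀ j, G.Action i → G.Action j → ℝ) × ℝ × (G.Action i → ℝ) =>
      G.deviationProfile s i x.1 x.2.1 x.2.2 := by
  unfold deviationProfile
  refine Continuous.update ?_ i ?_ <;> fun_prop

/-- The maximum over a compact set depends continuously on the punishments, which themselves form a
compact set; `S` bounds the minimum from above. -/
theorem exists_isMinMaxDeviationUtility [∀ j, Nonempty (G.Action j)] (s : ∀ j, G.Action j → ℝ)
    (i : Fin n) {S : ∀ j, G.Action i → G.Action j → ℝ} (hS : ∀ j a, S j a ∈ G.strategies j)
    {y : ℝ} (hy : ∀ q ∈ Set.Icc (0 : ℝ) 1, ∀ s' ∈ G.strategies i,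
      G.mixedUtility i (G.deviationProfile s i S q s') ≤ y) :
    ∃ x, G.IsMinMaxDeviationUtility s i x ∧ x ≤ y := by
  set K : Set (ℝ × (G.Action i → ℝ)) := Set.Icc (0 : ℝ) 1 ×ˢ G.strategies i
  have hK : IsCompact K := isCompact_Icc.prod (isCompact_stdSimplex ℝ _)
  have hKne : K.Nonempty := by
    classical
    exact ⟨(0, Pi.single (Classical.arbitrary _) 1), by simp, single_mem_stdSimplex ℝ _⟩
  set F : (∀ j, G.Action i → G.Action j → ℝ) → ℝ × (G.Action i → ℝ) → ℝ := fun S x =>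
    G.mixedUtility i (G.deviationProfile s i S x.1 x.2)
  have hF : Continuous fun x : (∀ j, G.Action i → G.Action j → ℝ) × ℝ × (G.Action i → ℝ) =>
      F x.1 x.2 := (G.continuous_mixedUtility i).comp (G.continuous_deviationProfile s i)
  have hset : ∀ S, {y : ℝ | ∃ q ∈ Set.Icc (0 : ℝ) 1, ∃ s' ∈ G.strategies i,
      y = G.mixedUtility i (G.deviationProfile s i S q s')} = F S '' K := by
    intro S
    ext y
    constructor
    · rintro ⟨q, hq, s', hs', rfl⟩; exact ⟨(q, s'), ⟨hq, hs'⟩, rfl⟩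
    · rintro ⟨⟨q, s'⟩, ⟨hq, hs'⟩, rfl⟩; exact ⟨q, hq, s', hs', rfl⟩
  have hmax : ∀ S, G.IsMaxDeviationUtility s i S (sSup (F S '' K)) := by
    intro S
    rw [IsMaxDeviationUtility, hset]
    exact (hK.image (hF.comp (Continuous.prodMk_right S))).isGreatest_sSup (hKne.image _)
  have hcont : Continuous fun S => sSup (F S '' K) := hK.continuous_sSup hF
  set P : Set (∀ j, G.Action i → G.Action j → ℝ) :=
    Set.pi Set.univ fun j => Set.pi Set.univ fun _ => G.strategies j
  have hP : IsCompact P := isCompact_univ_pi fun j => isCompact_univ_pi fun _ =>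
    isCompact_stdSimplex ℝ _
  have hSP : S ∈ P := fun j _ a _ => hS j a
  obtain ⟨S₀, hS₀, hmin⟩ := hP.exists_isMinOn ⟨S, hSP⟩ hcont.continuousOn
  refine ⟨sSup (F S₀ '' K), ⟨⟨S₀, fun j a => hS₀ j trivial a trivial, hmax S₀⟩, ?_⟩, ?_⟩
  · rintro z ⟨S', hS', hz⟩
    rw [hz.unique (hmax S')]
    exact hmin fun j _ a _ => hS' j a
  · refine (hmin hSP).trans (csSup_le (hKne.image _) ?_)
    rintro _ ⟨⟨q, s'⟩, ⟨hq, hs'⟩, rfl⟩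
    exact hy q hq s' hs'

end Game

section Main

variable {n : ℕ} {G : Game n} {θ : ℕ → ℝ} {p : Fin n → Code} {ε : Fin n → ℝ}
  {π : ∀ i, Policy G i}

/-! ### Equilibria of grounded bots -/

theorem exists_one_div_le (hε : ∀ k, 0 < ε k) : ∃ E : ℕ, ∀ k, 1 / ((E : ℝ) + 1) ≤ ε k := by
  choose f hf using fun k => exists_nat_one_div_lt (hε k)
  -- The sum dominates every `f k`, so one `E` serves all players.
  refine ⟨∑ k, f k, fun k => le_trans ?_ (hf k).le⟩
  have : f k ≤ ∑ k, f k := Finset.single_le_sum (fun _ _ => Nat.zero_le _) (Finset.mem_univ k)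
  gcongr

/-- The profile of strategies that results if player `i` plays action `a` with weight `w a`,
and imitates its equilibrium program otherwise. -/
noncomputable def mixture (θ : ℕ → ℝ) (p : Fin n → Code) (i : Fin n) (w : G.Action i → ℝ) :
    ∀ j, G.Action j → ℝ := fun j b =>
  (1 - ∑ a, w a) * inducedStrategy G θ p j b +
    ∑ a, w a * inducedStrategy G θ (constProfile p i (some a)) j b

/-- With common denominator `D + 1`, the partial sums of `w` are the thresholds of a deviation
program, to which the equilibrium condition applies. -/
theorem mixedUtility_mixture_nat_le (hbot : ∀ i, IsGroundedBot G θ i (ε i) (π i) (p i))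
    (heq : IsProgramEquilibrium G θ p) (i : Fin n) (w : G.Action i → ℕ) {D : ℕ}
    (hw : ∑ a, w a ≤ D + 1) :
    G.mixedUtility i (mixture θ p i fun a => w a / ((D : ℝ) + 1)) ≤ programUtility G θ p i := by
  obtain ⟨E, hE⟩ := exists_one_div_le fun k => (hbot k).1
  set g : ℕ → ℕ := fun a => if h : a < G.numActions i then w ⟨a, h⟩ else 0
  set C : ℕ → ℕ := fun a => ∑ b ∈ Finset.range a, g b with hCdef
  have hC : Monotone C := fun a b hab =>
    Finset.sum_le_sum_of_subset (Finset.range_mono hab)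
  have hsucc : ∀ a, C (a + 1) = C a + g a := fun a => Finset.sum_range_succ g a
  have hg : ∀ a : G.Action i, g a = w a := fun a => dif_pos a.2
  have hCA : C (G.numActions i) = ∑ a, w a := by
    simp only [hCdef, Finset.sum_range, hg]
  have hmix : inducedStrategy G θ (deviationPlay G p i E D C) =
      mixture θ p i fun a => w a / ((D : ℝ) + 1) := by
    funext k b
    rw [inducedStrategy_deviationPlay hbot i hE hC rfl (hCA ▸ hw), mixture, hCA,
      ← Finset.sum_div]
    push_cast
    congr 1
    refine Finset.sum_congr rfl fun a _ => ?_
    rw [hsucc, hg]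
    push_cast
    ring
  rw [← hmix, ← programUtility_eq]
  exact heq.2 i _ (deviationPlay_halts hbot i hE D hC rfl)

theorem mixedUtility_mixture_le (hbot : ∀ i, IsGroundedBot G θ i (ε i) (π i) (p i))
    (heq : IsProgramEquilibrium G θ p) (i : Fin n) {w : G.Action i → ℝ} (hw0 : ∀ a, 0 ≤ w a)
    (hw : ∑ a, w a ≤ 1) :
    G.mixedUtility i (mixture θ p i w) ≤ programUtility G θ p i := by
  -- Rounding down keeps the total weight at most `1`, so the approximations are realizable by
  -- programs.
  have hlim : Filter.Tendsto (fun (D : ℕ) (a : G.Action i) =>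
      (⌊w a * ((D : ℝ) + 1)⌋₊ : ℝ) / ((D : ℝ) + 1)) Filter.atTop (nhds w) := by
    refine tendsto_pi_nhds.2 fun a => (tendsto_nat_floor_mul_div_atTop (hw0 a)).comp ?_
    exact Filter.tendsto_atTop_add_const_right _ _ tendsto_natCast_atTop_atTop
  have hcont : Continuous fun w : G.Action i → ℝ => G.mixedUtility i (mixture θ p i w) := by
    refine (G.continuous_mixedUtility i).comp ?_
    unfold mixture
    fun_prop
  refine le_of_tendsto' ((hcont.tendsto w).comp hlim) fun D => ?_
  refine mixedUtility_mixture_nat_le hbot heq i (fun a => ⌊w a * ((D : ℝ) + 1)⌋₊) ?_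
  have hpos : (0 : ℝ) ≤ (D : ℝ) + 1 := by positivity
  have : (∑ a, (⌊w a * ((D : ℝ) + 1)⌋₊ : ℝ)) ≤ (D : ℝ) + 1 :=
    calc (∑ a, (⌊w a * ((D : ℝ) + 1)⌋₊ : ℝ)) ≤ ∑ a, w a * ((D : ℝ) + 1) :=
          Finset.sum_le_sum fun a _ => Nat.floor_le (mul_nonneg (hw0 a) hpos)
      _ = (∑ a, w a) * ((D : ℝ) + 1) := (Finset.sum_mul ..).symm
      _ ≤ (D : ℝ) + 1 := mul_le_of_le_one_left hpos hw
  exact_mod_cast this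

theorem inducedStrategy_constProfile_self (i : Fin n) (a b : G.Action i) :
    inducedStrategy G θ (constProfile p i (some a)) i b = if b = a then 1 else 0 := by
  rw [inducedStrategy_eq]
  by_cases h : b = a <;> simp [apply_constProfile_some, h]

/-- The weights `q * s' a` sum to `q`, and player `i`'s own response to the constant program `a` is
the point mass at `a`. -/
theorem deviationProfile_eq_mixture (i : Fin n) (q : ℝ) {s' : G.Action i → ℝ}
    (hs' : s' ∈ G.strategies i) :
    G.deviationProfile (inducedStrategy G θ p) i
      (fun j a => inducedStrategy G θ (constProfile p i (some a)) j) q s' =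
      mixture θ p i fun a => q * s' a := by
  have hsum : ∑ a, q * s' a = q := by rw [← Finset.mul_sum, hs'.2, mul_one]
  funext j b
  by_cases hj : j = i
  · subst hj
    simp [Game.deviationProfile, mixture, hsum, inducedStrategy_constProfile_self]
  · simp [Game.deviationProfile, mixture, hsum, hj, Finset.mul_sum, mul_assoc]

end Main

end ProgramGames

theorem mainTheorem6 {n : ℕ} (G : ProgramGames.Game n) (θ : ℕ → ℝ)
    (p : Fin n → ProgramGames.Code) (ε : Fin n → ℝ) (π : ∀ i, ProgramGames.Policy G i)
    (hbot : ∀ i, ProgramGames.IsGroundedBot G θ i (ε i) (π i) (p i))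
    (heq : ProgramGames.IsProgramEquilibrium G θ p)
    (v : Fin n → ℝ) (hv : ∀ i, v i = ProgramGames.programUtility G θ p i)
    (s : ∀ j, G.Action j → ℝ) (hs : s = ProgramGames.inducedStrategy G θ p) :
    G.Feasible v ∧
    (∀ j, s j ∈ G.strategies j) ∧
    (∀ i, v i = G.mixedUtility i s) ∧
    ∀ i, ∃ x : ℝ, G.IsMinMaxDeviationUtility s i x ∧ x ≤ v i := by
  subst hs
  obtain ⟨E, hE⟩ := ProgramGames.exists_one_div_le fun k => (hbot k).1
  have hδ : 0 < 1 / ((E : ℝ) + 1) := by positivity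
  have hmem : ∀ j, ProgramGames.inducedStrategy G θ p j ∈ G.strategies j := fun j =>
    ProgramGames.inducedStrategy_mem <| by
      filter_upwards [ProgramGames.ae_constProfile_dom hbot hδ hE j none] with r hr using hr j
  have hutil : ∀ i, v i = G.mixedUtility i (ProgramGames.inducedStrategy G θ p) := fun i => by
    rw [hv i, ProgramGames.programUtility_eq]
  refine ⟨⟨_, hmem, hutil⟩, hmem, hutil, fun i => ?_⟩
  -- A single halting run exhibits an action of every player.
  have hne : ∀ j, Nonempty (G.Action j) := fun j => by
    obtain ⟨ω, hω⟩ := heq.1.exists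
    obtain ⟨a, _⟩ := Part.dom_iff_mem.1 (hω j)
    exact ⟨a⟩
  -- The punishments are the bots' actual responses to constant programs.
  refine G.exists_isMinMaxDeviationUtility _ i
    (S := fun j a => ProgramGames.inducedStrategy G θ (ProgramGames.constProfile p i (some a)) j)
    (fun j a => ProgramGames.inducedStrategy_mem ?_) fun q hq s' hs' => ?_
  · filter_upwards [ProgramGames.ae_constProfile_dom hbot hδ hE i (some a)] with r hr using hr j
  · rw [ProgramGames.deviationProfile_eq_mixture i q hs', hv i]
    refine ProgramGames.mixedUtility_mixture_le hbot heq i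
      (fun a => mul_nonneg hq.1 (hs'.1 a)) ?_
    rw [← Finset.mul_sum, hs'.2, mul_one]
    exact hq.2
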